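/- Let $m\ge 1$, $d=2m$, and let $A^{(1)},A^{(2)}$ be real $m\times d$ matrices with $\mathcal N(A^{(1)})\cap\mathcal N(A^{(2)})=\{0\}$, where $\mathcal N$ denotes the null space. For $u\in L^\infty(\mathbb R^2;\mathbb R^d)$ put $\mathcal A u=A^{(1)}\partial_{x_1}u+A^{(2)}\partial_{x_2}u$ in the sense of distributions, and let $$\Lambda=\{v\in\mathbb R^d:\ \exists\, w\in\mathbb R^2\setminus\{0\},\ (w_1A^{(1)}+w_2A^{(2)})v=0\}.$$ A function $G:\mathbb R^d\to\mathbb R\cup\{+\infty\}$ is called $\Lambda$-convex if $G(ta+(1-t)b)\le tG(a)+(1-t)G(b)$ whenever $b-a\in\Lambda$ and $t\in(0,1)$. For $E\subset\mathbb R^d$ let $\Lambda\mathrm{co}E$ be the set of all $\xi\in\mathbb R^d$ such that $G(\xi)\le 0$ for every $\Lambda$-convex $G:\mathbb R^d\to\mathbb R\cup\{+\infty\}$ that vanishes on $E$. Let $F:\mathbb R^d\to\mathbb R$ be continuous, $\Lambda$-convex and coercive, i.e. $F(\xi)\to+\infty$ as $|\xi|\to\infty$, and let $E=\{\xi: F(\xi)=0\}$.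 Then $$\Lambda\mathrm{co}E=\{\xi\in\mathbb R^d: F(\xi)\le 0\},$$ and $\Lambda\mathrm{co}E$ has the relaxation property with respect to $E$. That is, writing $K=\Lambda\mathrm{co}E$: for every bounded open $\Omega\subset\mathbb R^2$ and every $\xi\in\operatorname{int}K$ there are bounded functions $u_n:\mathbb R^2\to\mathbb R^d$, each piecewise constant (constant on each of finitely many pairwise disjoint open sets that cover $\mathbb R^2$ up to a Lebesgue null set), such that - $u_n\overset{*}{\rightharpoonup}\xi$ in $L^\infty(\mathbb R^2;\mathbb R^d)$, - $u_n=\xi$ in $\mathbb R^2\setminus\Omega$ for every $n$, - $\mathcal A u_n=0$ in $\mathcal D'(\mathbb R^2;\mathbb R^m)$ for every $n$, - $u_n(x)\in E\cup\operatorname{int}K$ for a.e. $x\in\Omega$ and every $n$, - $\int_\Omega\operatorname{dist}(u_n(x);E)\,dx\to 0$ as $n\to\infty$. -/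

import Mathlib

open MeasureTheory Filter Topology
open scoped ContDiff

namespace AFree

/-- The symbol `∑ i, w i • A i` of the operator `𝒜 u = ∑ i, A i (∂u / ∂x_i)`, acting on `ℝ^d`. -/
noncomputable def symbol {N m d : ℕ} (A : Fin N → Matrix (Fin m) (Fin d) ℝ)
    (w : EuclideanSpace ℝ (Fin N)) :
    EuclideanSpace ℝ (Fin d) →ₗ[ℝ] EuclideanSpace ℝ (Fin m) :=
  Matrix.toEuclideanLin (∑ i, w i • A i)

/-- The characteristic cone `Λ` of `𝒜`. -/
def charCone {N m d : ℕ} (A : Fin N → Matrix (Fin m) (Fin d) ℝ) :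
    Set (EuclideanSpace ℝ (Fin d)) :=
  {v | ∃ w : EuclideanSpace ℝ (Fin N), w ≠ 0 ∧ symbol A w v = 0}

/-- `F : ℝ^d → ℝ ∪ {+∞}` is convex along the directions of the set `L`.  The values are taken in
the extended reals and the value `-∞` is excluded. -/
def IsConvexAlong {d : ℕ} (L : Set (EuclideanSpace ℝ (Fin d)))
    (F : EuclideanSpace ℝ (Fin d) → EReal) : Prop :=
  (∀ ξ, F ξ ≠ ⊥) ∧
    ∀ a b : EuclideanSpace ℝ (Fin d), b - a ∈ L → ∀ t : ℝ, 0 < t → t < 1 →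
      F (t • a + (1 - t) • b) ≤ (t : EReal) * F a + ((1 - t : ℝ) : EReal) * F b

/-- The laminate convex hull `Λco E`: the points where every `Λ`-convex
`G : ℝ^d → ℝ ∪ {+∞}` vanishing on `E` is nonpositive. -/
def laminateHull {d : ℕ} (L E : Set (EuclideanSpace ℝ (Fin d))) :
    Set (EuclideanSpace ℝ (Fin d)) :=
  {ξ | ∀ G : EuclideanSpace ℝ (Fin d) → EReal,
    IsConvexAlong L G → (∀ η ∈ E, G η = 0) → G ξ ≤ 0}

/-- `u ∈ L^∞_piec(ℝ^N; ℝ^d)`: `u` is bounded, and it is constant on each of finitely many pairwise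
disjoint open sets which cover `ℝ^N` up to a Lebesgue null set. -/
def IsBoundedPiecewiseConst {N d : ℕ}
    (u : EuclideanSpace ℝ (Fin N) → EuclideanSpace ℝ (Fin d)) : Prop :=
  (∃ C : ℝ, ∀ x, ‖u x‖ ≤ C) ∧
    ∃ (k : ℕ) (U : Fin k → Set (EuclideanSpace ℝ (Fin N)))
      (c : Fin k → EuclideanSpace ℝ (Fin d)),
      (∀ i, IsOpen (U i)) ∧ Pairwise (fun i j => Disjoint (U i) (U j)) ∧
      volume (⋃ i, U i)ᶜ = 0 ∧ ∀ i, ∀ x ∈ U i, u x = c i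

/-- `𝒜 u = 0` in `𝒟'(ℝ^N; ℝ^m)`, tested with `φ ∈ C_c^∞(ℝ^N; ℝ^m)`
(for bounded measurable `u`). -/
def IsDistribFree {N m d : ℕ} (A : Fin N → Matrix (Fin m) (Fin d) ℝ)
    (u : EuclideanSpace ℝ (Fin N) → EuclideanSpace ℝ (Fin d)) : Prop :=
  ∀ φ : EuclideanSpace ℝ (Fin N) → EuclideanSpace ℝ (Fin m),
    ContDiff ℝ ∞ φ → HasCompactSupport φ →
      ∫ x, ∑ i, inner ℝ (Matrix.toEuclideanLin (A i) (u x))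
        (fderiv ℝ φ x (EuclideanSpace.single i (1 : ℝ))) = 0

/-- Weak-* convergence in `L^∞(ℝ^N; ℝ^d)`: convergence against every `g ∈ L^1(ℝ^N; ℝ^d)`. -/
def WeakStarTendsto {N d : ℕ}
    (u : ℕ → EuclideanSpace ℝ (Fin N) → EuclideanSpace ℝ (Fin d))
    (v : EuclideanSpace ℝ (Fin N) → EuclideanSpace ℝ (Fin d)) : Prop :=
  ∀ g : EuclideanSpace ℝ (Fin N) → EuclideanSpace ℝ (Fin d), Integrable g volume →
    Tendsto (fun n => ∫ x, inner ℝ (u n x) (g x)) atTop (𝓝 (∫ x, inner ℝ (v x) (g x)))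

/-- The relaxation property of `K` with respect to `E`, for the operator `𝒜`.  The distance to `E`
is the extended one (`+∞` if `E` is empty). -/
def RelaxationProperty {N m d : ℕ} (A : Fin N → Matrix (Fin m) (Fin d) ℝ)
    (K E : Set (EuclideanSpace ℝ (Fin d))) : Prop :=
  ∀ Ω : Set (EuclideanSpace ℝ (Fin N)), IsOpen Ω → Bornology.IsBounded Ω →
    ∀ ξ ∈ interior K,
      ∃ u : ℕ → EuclideanSpace ℝ (Fin N) → EuclideanSpace ℝ (Fin d),
        (∀ n, IsBoundedPiecewiseConst (u n)) ∧
        WeakStarTendsto u (fun _ => ξ) ∧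
        (∀ n, ∀ x ∉ Ω, u n x = ξ) ∧
        (∀ n, IsDistribFree A (u n)) ∧
        (∀ n, ∀ᵐ x ∂(volume.restrict Ω), u n x ∈ E ∪ interior K) ∧
        Tendsto (fun n => ∫⁻ x in Ω, Metric.infEDist (u n x) E) atTop (𝓝 0)

end AFree

/-!
Write `𝒜 u = A₀ ∂₀u + A₁ ∂₁u`. As `d = 2m` and `ker A₀ ∩ ker A₁ = 0`, both kernels have dimension
`m` and `A₀` maps `ker A₁` isomorphically onto `ℝ^m`
(`AFree.exists_mem_ker_map_add_eq_zero`). So there are `b₀ ≠ 0` in `ker A₀` and `b₁` in `ker A₁`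
with `A₀ b₁ + A₁ b₀ = 0`, and `∂₀h • b₀ + ∂₁h • b₁` is `𝒜`-free for every Lipschitz `h`, because mixed
derivatives commute (`AFree.isDistribFree_potentialField`). The line `ℝ b₀` lies in `Λ`.

If `F ξ < 0`, coercivity gives zeros of `F` on both rays from `ξ` along `±b₀`. This puts `ξ` on a
`Λ`-segment with ends in `E = {F = 0}`, so a single lamination yields the hull
(`AFree.laminateHull_zero_set`). The relaxation also needs just one splitting. By convexity along
`b₀`, there are `ξ - s b₀` and `ξ + t b₀` in `{F < 0}` as close to `E` as desired, and a small `δ`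
keeps the four values `ξ - s b₀ ± δ b₁`, `ξ + t b₀ ± δ b₁` there as well
(`AFree.exists_tent_slopes`). They are exactly the values of `ξ + ∂₀h • b₀ + ∂₁h • b₁` when `h` is
the pyramid `max 0 (r - max (s y₀) (-t y₀) - δ |y₁|)`, which vanishes outside a quadrilateral: no
transition layer occurs inside a cell. By Vitali's theorem finitely many disjoint small translated
and scaled quadrilaterals fill `Ω` up to a small measure (`AFree.exists_tent_filling`). On the rest
the field equals `ξ`, which contributes little to the distance integral, and since the potentials
tend to `0` uniformly with bounded gradients, the fields converge weakly-* to `ξ`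
(`AFree.weakStarTendsto_potentialField`).

If `F ξ = 0`, the constant sequence `ξ` works.
-/

namespace AFree

local notation "Plane" => EuclideanSpace ℝ (Fin 2)

/-! ### Tents and their filling of open sets -/

/-- `h` agrees near `x` with an affine function of gradient `(p, q)`. -/
def IsAffineNear (h : Plane → ℝ) (x : Plane) (p q : ℝ) : Prop :=
  ∃ α : ℝ, h =ᶠ[𝓝 x] fun y => α + p * y 0 + q * y 1

/-- The asymmetric gauge `max (s y₀) (-t y₀) + δ |y₁|`, whose sublevel sets are the quadrilaterals
over which tents are pitched. The modulus is written as a maximum of linear functions. -/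
noncomputable def roof (s t δ : ℝ) (y : Plane) : ℝ :=
  max (s * y 0) (-t * y 0) + max (δ * y 1) (-δ * y 1)

/-- The pyramid of height `r` over the quadrilateral `roof s t δ (y - c) ≤ r`, extended by `0`. -/
noncomputable def tent (s t δ : ℝ) (c : Plane) (r : ℝ) (y : Plane) : ℝ :=
  max 0 (r - roof s t δ (y - c))

/-- The closed quadrilateral supporting `tent s t δ c r`. -/
def tentCell (s t δ : ℝ) (c : Plane) (r : ℝ) : Set Plane := {y | roof s t δ (y - c) ≤ r}

lemma exists_lipschitzWith_linear (a : ℝ) (i : Fin 2) :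
    ∃ L, LipschitzWith L fun y : Plane => a * y i :=
  ⟨_, (a • (EuclideanSpace.proj i : Plane →L[ℝ] ℝ)).lipschitz⟩

lemma exists_lipschitzWith_roof (s t δ : ℝ) : ∃ L, LipschitzWith L (roof s t δ) := by
  obtain ⟨L₁, h₁⟩ := exists_lipschitzWith_linear s 0
  obtain ⟨L₂, h₂⟩ := exists_lipschitzWith_linear (-t) 0
  obtain ⟨L₃, h₃⟩ := exists_lipschitzWith_linear δ 1
  obtain ⟨L₄, h₄⟩ := exists_lipschitzWith_linear (-δ) 1
  exact ⟨_, (h₁.max h₂).add (h₃.max h₄)⟩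

lemma continuous_roof (s t δ : ℝ) : Continuous (roof s t δ) :=
  (exists_lipschitzWith_roof s t δ).choose_spec.continuous

lemma exists_lipschitzWith_tent (s t δ : ℝ) (c : Plane) (r : ℝ) :
    ∃ L, LipschitzWith L (tent s t δ c r) := by
  obtain ⟨L, hL⟩ := exists_lipschitzWith_roof s t δ
  exact ⟨_, (((LipschitzWith.const r).sub
    (hL.comp (LipschitzWith.id.sub (LipschitzWith.const c)))).const_max 0)⟩

lemma exists_lipschitzWith_sum {ι : Type*} (T : Finset ι) (f : ι → Plane → ℝ)
    (hf : ∀ i ∈ T, ∃ L, LipschitzWith L (f i)) : ∃ L, LipschitzWith L fun y => ∑ i ∈ T, f i y := by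
  classical
  induction T using Finset.induction_on with
  | empty => exact ⟨0, by simp⟩
  | insert a T ha ih =>
    obtain ⟨L, hL⟩ := ih fun i hi => hf i (Finset.mem_insert_of_mem hi)
    obtain ⟨L', hL'⟩ := hf a (Finset.mem_insert_self a T)
    exact ⟨_, by simpa only [Finset.sum_insert ha] using hL'.add hL⟩

lemma isClosed_tentCell (s t δ : ℝ) (c : Plane) (r : ℝ) : IsClosed (tentCell s t δ c r) :=
  isClosed_le ((continuous_roof s t δ).comp (continuous_id.sub continuous_const)) continuous_const

lemma tent_eq_zero {s t δ : ℝ} {c : Plane} {r : ℝ} {y : Plane} (hy : y ∉ tentCell s t δ c r) :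
    tent s t δ c r y = 0 := by
  simp only [tentCell, Set.mem_ofPred_eq, not_le] at hy
  exact max_eq_left (by linarith)

lemma norm_le_abs_add_abs (y : Plane) : ‖y‖ ≤ |y 0| + |y 1| := by
  rw [EuclideanSpace.norm_eq, Real.sqrt_le_left (by positivity)]
  simp only [Fin.sum_univ_two, Real.norm_eq_abs]
  nlinarith [abs_nonneg (y 0), abs_nonneg (y 1)]

lemma le_roof {s t δ : ℝ} (hs : 0 < s) (ht : 0 < t) (hδ : 0 < δ) (y : Plane) :
    min (min s t) δ * ‖y‖ ≤ roof s t δ y := by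
  have hκ : 0 ≤ min (min s t) δ := by positivity
  have h1 : min (min s t) δ * |y 0| ≤ max (s * y 0) (-t * y 0) := by
    have h1 : min (min s t) δ ≤ s := (min_le_left _ _).trans (min_le_left _ _)
    have h2 : min (min s t) δ ≤ t := (min_le_left _ _).trans (min_le_right _ _)
    rcases abs_cases (y 0) with ⟨h, h'⟩ | ⟨h, h'⟩
    · exact le_max_of_le_left (by rw [h]; nlinarith)
    · exact le_max_of_le_right (by rw [h]; nlinarith)
  have h2 : min (min s t) δ * |y 1| ≤ max (δ * y 1) (-δ * y 1) := by
    have h1 : min (min s t) δ ≤ δ := min_le_right _ _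
    rcases abs_cases (y 1) with ⟨h, h'⟩ | ⟨h, h'⟩
    · exact le_max_of_le_left (by rw [h]; nlinarith)
    · exact le_max_of_le_right (by rw [h]; nlinarith)
  calc _ ≤ min (min s t) δ * (|y 0| + |y 1|) := by gcongr; exact norm_le_abs_add_abs y
    _ ≤ _ := by rw [mul_add]; exact add_le_add h1 h2

lemma roof_nonneg {s t δ : ℝ} (hs : 0 < s) (ht : 0 < t) (hδ : 0 < δ) (y : Plane) :
    0 ≤ roof s t δ y := le_trans (by positivity) (le_roof hs ht hδ y)

lemma roof_le {s t δ : ℝ} (hs : 0 < s) (ht : 0 < t) (hδ : 0 < δ) (y : Plane) :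
    roof s t δ y ≤ (s + t + δ) * ‖y‖ := by
  have h0 := abs_le.1 ((Real.norm_eq_abs _).symm.trans_le (PiLp.norm_apply_le y 0))
  have h1 := abs_le.1 ((Real.norm_eq_abs _).symm.trans_le (PiLp.norm_apply_le y 1))
  have hn := norm_nonneg y
  have e1 : max (s * y 0) (-t * y 0) ≤ (s + t) * ‖y‖ := max_le (by nlinarith) (by nlinarith)
  have e2 : max (δ * y 1) (-δ * y 1) ≤ δ * ‖y‖ := max_le (by nlinarith) (by nlinarith)
  unfold roof
  linarith

lemma tentCell_subset_closedBall {s t δ : ℝ} (hs : 0 < s) (ht : 0 < t) (hδ : 0 < δ) (c : Plane)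
    (r : ℝ) : tentCell s t δ c r ⊆ Metric.closedBall c (r / min (min s t) δ) := by
  intro y hy
  have hκ : 0 < min (min s t) δ := by positivity
  rw [Metric.mem_closedBall, dist_eq_norm, le_div_iff₀ hκ, mul_comm]
  exact (le_roof hs ht hδ _).trans hy

lemma closedBall_subset_tentCell {s t δ : ℝ} (hs : 0 < s) (ht : 0 < t) (hδ : 0 < δ) (c : Plane)
    (r : ℝ) : Metric.closedBall c (r / (s + t + δ)) ⊆ tentCell s t δ c r := by
  intro y hy
  rw [Metric.mem_closedBall, dist_eq_norm, le_div_iff₀ (by positivity), mul_comm] at hy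
  exact (roof_le hs ht hδ _).trans hy

/-- Lines are Lebesgue null. -/
lemma ae_ne_of_linear (a b k : ℝ) (hab : a ≠ 0 ∨ b ≠ 0) :
    ∀ᵐ y : Plane, a * y 0 + b * y 1 ≠ k := by
  let f : Plane →L[ℝ] ℝ := a • EuclideanSpace.proj 0 + b • EuclideanSpace.proj 1
  have hf : ∀ y, f y = a * y 0 + b * y 1 := fun y => rfl
  have hne : f.toLinearMap ≠ 0 := by
    intro h
    have h0 := LinearMap.congr_fun h (EuclideanSpace.single 0 1)
    have h1 := LinearMap.congr_fun h (EuclideanSpace.single 1 1)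
    simp [hf] at h0 h1
    tauto
  exact (ae_comp_linearMap_mem_iff f.toLinearMap (volume : Measure Plane) (volume : Measure ℝ)
    (LinearMap.surjective hne) (measurableSet_singleton k).compl).2 (by simp [ae_iff])

/-- Off finitely many lines, a tent is locally affine inside its cell, with one of four gradients:
`(-s, ±δ)` or `(t, ±δ)`. -/
lemma ae_tent_isAffineNear {s t δ : ℝ} (hs : 0 < s) (ht : 0 < t) (hδ : 0 < δ) (c : Plane) (r : ℝ) :
    ∀ᵐ x : Plane, x ∈ tentCell s t δ c r → ∃ p q : ℝ, (p = -s ∨ p = t) ∧ (q = δ ∨ q = -δ) ∧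
      IsAffineNear (tent s t δ c r) x p q := by
  filter_upwards [ae_ne_of_linear 1 0 (c 0) (by simp), ae_ne_of_linear 0 1 (c 1) (by simp),
    ae_ne_of_linear s δ (r + s * c 0 + δ * c 1) (by simp [hs.ne']),
    ae_ne_of_linear s (-δ) (r + s * c 0 - δ * c 1) (by simp [hs.ne']),
    ae_ne_of_linear (-t) δ (r - t * c 0 + δ * c 1) (by simp [ht.ne']),
    ae_ne_of_linear (-t) (-δ) (r - t * c 0 - δ * c 1) (by simp [ht.ne'])]
    with x h0 h1 h2 h3 h4 h5 hx
  simp only [one_mul, zero_mul, add_zero, zero_add] at h0 h1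
  -- a tent descends from its apex, so its gradient is minus that of the gauge
  have key : ∀ p' q' : ℝ, p' * x 0 + q' * x 1 ≠ r + p' * c 0 + q' * c 1 →
      (∀ᶠ y in 𝓝 x, roof s t δ (y - c) = p' * (y - c) 0 + q' * (y - c) 1) →
      IsAffineNear (tent s t δ c r) x (-p') (-q') := by
    intro p' q' hne hev
    refine ⟨r + p' * c 0 + q' * c 1, ?_⟩
    have hlt : roof s t δ (x - c) < r := by
      refine lt_of_le_of_ne hx fun h => hne ?_
      have := hev.self_of_nhds
      simp only [PiLp.sub_apply] at this
      linarith
    have hev2 : ∀ᶠ y in 𝓝 x, roof s t δ (y - c) < r :=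
      (((continuous_roof s t δ).comp (continuous_id.sub continuous_const)).tendsto x).eventually
        (gt_mem_nhds hlt)
    filter_upwards [hev, hev2] with y hy hy2
    rw [tent, max_eq_right (by linarith), hy]
    simp only [PiLp.sub_apply]
    ring
  have c0 : Continuous fun y : Plane => y 0 := by fun_prop
  have c1 : Continuous fun y : Plane => y 1 := by fun_prop
  have r0 : ∀ y : Plane, c 0 < y 0 → max (s * (y - c) 0) (-t * (y - c) 0) = s * (y - c) 0 := by
    intro y hy
    simp only [PiLp.sub_apply]
    exact max_eq_left (by nlinarith)
  have r0' : ∀ y : Plane, y 0 < c 0 → max (s * (y - c) 0) (-t * (y - c) 0) = -t * (y - c) 0 := by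
    intro y hy
    simp only [PiLp.sub_apply]
    exact max_eq_right (by nlinarith)
  have r1 : ∀ y : Plane, c 1 < y 1 → max (δ * (y - c) 1) (-δ * (y - c) 1) = δ * (y - c) 1 := by
    intro y hy
    simp only [PiLp.sub_apply]
    exact max_eq_left (by nlinarith)
  have r1' : ∀ y : Plane, y 1 < c 1 → max (δ * (y - c) 1) (-δ * (y - c) 1) = -δ * (y - c) 1 := by
    intro y hy
    simp only [PiLp.sub_apply]
    exact max_eq_right (by nlinarith)
  rcases lt_or_gt_of_ne h0 with h0 | h0 <;> rcases lt_or_gt_of_ne h1 with h1 | h1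
  · refine ⟨t, δ, by simp, by simp, ?_⟩
    have := key (-t) (-δ) (by convert h5 using 1; ring) (by
      filter_upwards [c0.tendsto x |>.eventually (gt_mem_nhds h0),
        c1.tendsto x |>.eventually (gt_mem_nhds h1)] with y hy hy'
      rw [roof, r0' y hy, r1' y hy'])
    simpa using this
  · refine ⟨t, -δ, by simp, by simp, ?_⟩
    have := key (-t) δ (by convert h4 using 1; ring) (by
      filter_upwards [c0.tendsto x |>.eventually (gt_mem_nhds h0),
        c1.tendsto x |>.eventually (lt_mem_nhds h1)] with y hy hy'
      rw [roof, r0' y hy, r1 y hy'])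
    simpa using this
  · refine ⟨-s, δ, by simp, by simp, ?_⟩
    have := key s (-δ) (by convert h3 using 1; ring) (by
      filter_upwards [c0.tendsto x |>.eventually (lt_mem_nhds h0),
        c1.tendsto x |>.eventually (gt_mem_nhds h1)] with y hy hy'
      rw [roof, r0 y hy, r1' y hy'])
    simpa using this
  · refine ⟨-s, -δ, by simp, by simp, ?_⟩
    exact key s δ h2 (by
      filter_upwards [c0.tendsto x |>.eventually (lt_mem_nhds h0),
        c1.tendsto x |>.eventually (lt_mem_nhds h1)] with y hy hy'
      rw [roof, r0 y hy, r1 y hy'])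

/-- Vitali covering: finitely many disjoint small tent cells exhaust a bounded open set up to a
small measure. -/
lemma exists_finset_tentCell {s t δ : ℝ} (hs : 0 < s) (ht : 0 < t) (hδ : 0 < δ) {Ω : Set Plane}
    (hΩ : IsOpen Ω) (hb : Bornology.IsBounded Ω) {ρ : ℝ} (hρ : 0 < ρ) :
    ∃ T : Finset (Plane × ℝ), (∀ a ∈ T, 0 < a.2 ∧ a.2 ≤ ρ ∧ tentCell s t δ a.1 a.2 ⊆ Ω) ∧
      (T : Set (Plane × ℝ)).PairwiseDisjoint (fun a => tentCell s t δ a.1 a.2) ∧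
      volume (Ω \ ⋃ a ∈ T, tentCell s t δ a.1 a.2) ≤ ENNReal.ofReal ρ := by
  classical
  set κ := min (min s t) δ with hκdef
  have hκ : 0 < κ := by positivity
  set M := s + t + δ with hM
  have hMpos : 0 < M := by positivity
  set B : Plane × ℝ → Set Plane := fun a => tentCell s t δ a.1 a.2 with hB
  obtain ⟨u, hut, huc, hud, hu0⟩ := Vitali.exists_disjoint_covering_ae (volume : Measure Plane) Ω
    {a : Plane × ℝ | 0 < a.2 ∧ a.2 ≤ ρ ∧ B a ⊆ Ω}
    -- a cell at scale `r` lies between the balls of radius `r / M` and `r / κ`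
    (Real.toNNReal ((3 * M / κ) ^ Module.finrank ℝ Plane)) (fun a => a.2 / κ) (fun a => a.1) B
    (fun a _ => tentCell_subset_closedBall hs ht hδ _ _)
    (fun a ha => by
      have e : 3 * (a.2 / κ) = (3 * M / κ) * (a.2 / M) := by field_simp
      have hr : 0 ≤ a.2 / M := div_nonneg ha.1.le hMpos.le
      rw [e, Measure.addHaar_closedBall_mul _ _ (by positivity) hr,
        ← Measure.addHaar_closedBall_center volume a.1 (a.2 / M)]
      exact mul_le_mul_right (measure_mono (closedBall_subset_tentCell hs ht hδ _ _)) _)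
    (fun a ha => by
      refine ⟨a.1, mem_interior_iff_mem_nhds.2 (mem_of_superset
        (Metric.closedBall_mem_nhds a.1 (div_pos ha.1 hMpos))
        (closedBall_subset_tentCell hs ht hδ _ _))⟩)
    (fun a _ => isClosed_tentCell _ _ _ _ _)
    (fun x hx ε hε => by
      obtain ⟨η, hη, hsub⟩ := Metric.nhds_basis_closedBall.mem_iff.1 (hΩ.mem_nhds hx)
      refine ⟨(x, min ρ (κ * min ε η)), ⟨by positivity, min_le_left _ _, ?_⟩, ?_, rfl⟩
      · refine (tentCell_subset_closedBall hs ht hδ _ _).trans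
          ((Metric.closedBall_subset_closedBall ?_).trans hsub)
        rw [div_le_iff₀ hκ, mul_comm]
        exact (min_le_right _ _).trans (by gcongr; exact min_le_right _ _)
      · simp only
        rw [div_le_iff₀ hκ, mul_comm]
        exact (min_le_right _ _).trans (by gcongr; exact min_le_left _ _))
  have : Countable u := huc
  have hfin : volume Ω ≠ ⊤ := hb.measure_lt_top.ne
  -- the parts of `Ω` missed by finite subfamilies decrease to the null set missed by all of `u`
  have hlim := tendsto_measure_iInter_atTop (μ := (volume : Measure Plane))
    (s := fun T : Finset u => Ω \ ⋃ a ∈ T, B a)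
    (fun T => (hΩ.measurableSet.diff (Finset.measurableSet_biUnion _ fun a _ =>
      (isClosed_tentCell _ _ _ _ _).measurableSet)).nullMeasurableSet)
    (fun T T' h => Set.sdiff_subset_sdiff_right (Set.biUnion_subset_biUnion_left h))
    ⟨∅, by simpa using hfin⟩
  have hzero : volume (⋂ T : Finset u, Ω \ ⋃ a ∈ T, B a) = 0 := by
    refine measure_mono_null ?_ hu0
    intro x hx
    simp only [Set.mem_iInter, Set.mem_sdiff, Set.mem_iUnion, not_exists] at hx ⊢
    exact ⟨(hx ∅).1, fun a ha => (hx {⟨a, ha⟩}).2 ⟨a, ha⟩ (by simp)⟩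
  rw [hzero] at hlim
  obtain ⟨T, hT⟩ := (hlim.eventually (ge_mem_nhds (ENNReal.ofReal_pos.2 hρ))).exists
  refine ⟨T.image (↑), ?_, ?_, ?_⟩
  · intro a ha
    obtain ⟨b, -, rfl⟩ := Finset.mem_image.1 ha
    exact hut b.2
  · refine hud.subset ?_
    intro a ha
    obtain ⟨b, -, rfl⟩ := Finset.mem_image.1 (Finset.mem_coe.1 ha)
    exact b.2
  · simpa [Finset.set_biUnion_finset_image] using hT

/-- A small potential on `Ω` made of finitely many disjoint tents. Its gradient is `0` off their
union `C` and one of `(-s, ±δ)`, `(t, ±δ)` on `C`, which is almost all of `Ω`. -/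
theorem exists_tent_filling {s t δ : ℝ} (hs : 0 < s) (ht : 0 < t) (hδ : 0 < δ) {Ω : Set Plane}
    (hΩ : IsOpen Ω) (hb : Bornology.IsBounded Ω) {ρ : ℝ} (hρ : 0 < ρ) :
    ∃ (h : Plane → ℝ) (C : Set Plane), (∃ L, LipschitzWith L h) ∧ tsupport h ⊆ Ω ∧
      (∀ x, |h x| ≤ ρ) ∧ IsClosed C ∧
      volume (Ω \ C) ≤ ENNReal.ofReal ρ ∧
      ∀ᵐ x, (x ∉ C ∧ IsAffineNear h x 0 0) ∨ (x ∈ C ∧ ∃ p q : ℝ,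
        (p = -s ∨ p = t) ∧ (q = δ ∨ q = -δ) ∧ IsAffineNear h x p q) := by
  classical
  obtain ⟨T, hT, hdisj, hvol⟩ := exists_finset_tentCell hs ht hδ hΩ hb hρ
  set B : Plane × ℝ → Set Plane := fun a => tentCell s t δ a.1 a.2 with hB
  set h : Plane → ℝ := fun y => ∑ a ∈ T, tent s t δ a.1 a.2 y with hh
  have hCclosed : IsClosed (⋃ a ∈ T, B a) :=
    T.finite_toSet.isClosed_biUnion fun a _ => isClosed_tentCell _ _ _ _ _
  have hCΩ : (⋃ a ∈ T, B a) ⊆ Ω := Set.iUnion₂_subset fun a ha => (hT a ha).2.2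
  have hout : ∀ y ∉ ⋃ a ∈ T, B a, h y = 0 := by
    intro y hy
    simp only [Set.mem_iUnion, not_exists] at hy
    exact Finset.sum_eq_zero fun a ha => tent_eq_zero (hy a ha)
  have hin : ∀ a ∈ T, ∀ y, (∀ b ∈ T, b ≠ a → y ∉ B b) → h y = tent s t δ a.1 a.2 y := by
    intro a ha y hy
    exact Finset.sum_eq_single_of_mem a ha fun b hb hne => tent_eq_zero (hy b hb hne)
  have hother : ∀ a ∈ T, ∀ y ∈ B a, ∀ b ∈ T, b ≠ a → y ∉ B b := by
    intro a ha y hy b hb hne hyb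
    exact Set.disjoint_left.1 (hdisj hb ha hne) hyb hy
  have hts : tsupport h ⊆ ⋃ a ∈ T, B a :=
    closure_minimal (fun y hy => by_contra fun hc => hy (hout y hc)) hCclosed
  refine ⟨h, ⋃ a ∈ T, B a,
    exists_lipschitzWith_sum T _ fun a _ => exists_lipschitzWith_tent _ _ _ _ _,
    hts.trans hCΩ, ?_, hCclosed, hvol, ?_⟩
  · intro x
    by_cases hx : x ∈ ⋃ a ∈ T, B a
    · simp only [Set.mem_iUnion] at hx
      obtain ⟨a, ha, hxa⟩ := hx
      rw [hin a ha x (hother a ha x hxa), abs_of_nonneg (le_max_left _ _)]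
      exact max_le hρ.le (by linarith [(hT a ha).2.1, roof_nonneg hs ht hδ (x - a.1)])
    · rw [hout x hx, abs_zero]; exact hρ.le
  · have hae : ∀ᵐ x : Plane, ∀ a ∈ T, x ∈ B a → ∃ p q : ℝ, (p = -s ∨ p = t) ∧
        (q = δ ∨ q = -δ) ∧ IsAffineNear (tent s t δ a.1 a.2) x p q :=
      (ae_ball_iff T.countable_toSet).2 fun a _ => ae_tent_isAffineNear hs ht hδ a.1 a.2
    filter_upwards [hae] with x hx
    by_cases hxC : x ∈ ⋃ a ∈ T, B a
    · refine Or.inr ⟨hxC, ?_⟩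
      simp only [Set.mem_iUnion] at hxC
      obtain ⟨a, ha, hxa⟩ := hxC
      obtain ⟨p, q, hp, hq, α, hα⟩ := hx a ha hxa
      refine ⟨p, q, hp, hq, α, ?_⟩
      have hev : ∀ᶠ y in 𝓝 x, ∀ b ∈ T, b ≠ a → y ∉ B b := by
        rw [Filter.eventually_all_finset]
        intro b hb
        by_cases hne : b = a
        · simp [hne]
        · have := (isClosed_tentCell s t δ b.1 b.2).isOpen_compl.mem_nhds
            (hother a ha x hxa b hb hne)
          filter_upwards [this] with y hy _ using hy
      filter_upwards [hev, hα] with y hy hy'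
      rw [hin a ha y hy, hy']
    · refine Or.inl ⟨hxC, 0, ?_⟩
      filter_upwards [hCclosed.isOpen_compl.mem_nhds hxC] with y hy
      rw [hout y hy]; simp

/-! ### Fields derived from a potential -/

/-- The partial derivative `∂h / ∂x_i`, with value `0` where it does not exist. -/
noncomputable def partialDeriv (i : Fin 2) (h : Plane → ℝ) (x : Plane) : ℝ :=
  lineDeriv ℝ h x (EuclideanSpace.single i 1)

/-- The perturbation `ξ + ∂₀h • b₀ + ∂₁h • b₁` of the constant state `ξ` by the potential `h`. -/
noncomputable def potentialField {d : ℕ} (ξ b₀ b₁ : EuclideanSpace ℝ (Fin d)) (h : Plane → ℝ)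
    (x : Plane) : EuclideanSpace ℝ (Fin d) :=
  ξ + partialDeriv 0 h x • b₀ + partialDeriv 1 h x • b₁

lemma IsAffineNear.partialDeriv_eq {h : Plane → ℝ} {x : Plane} {p q : ℝ}
    (hx : IsAffineNear h x p q) : partialDeriv 0 h x = p ∧ partialDeriv 1 h x = q := by
  obtain ⟨α, hα⟩ := hx
  have key : ∀ v : Plane, lineDeriv ℝ h x v = p * v 0 + q * v 1 := by
    intro v
    rw [hα.lineDeriv_eq]
    let f : Plane →L[ℝ] ℝ := p • EuclideanSpace.proj 0 + q • EuclideanSpace.proj 1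
    have hf : HasFDerivAt (fun y : Plane => α + p * y 0 + q * y 1) f x := by
      have := (f.hasFDerivAt (x := x)).const_add α
      refine this.congr_of_eventuallyEq (Eventually.of_forall fun y => ?_)
      simp [f, add_assoc]
    rw [(hf.hasLineDerivAt v).lineDeriv]
    simp [f]
  constructor <;> simp [partialDeriv, key]

lemma IsAffineNear.eventually {h : Plane → ℝ} {x : Plane} {p q : ℝ} (hx : IsAffineNear h x p q) :
    ∀ᶠ y in 𝓝 x, IsAffineNear h y p q := by
  obtain ⟨α, hα⟩ := hx
  filter_upwards [hα.eventuallyEq_nhds] with y hy using ⟨α, hy⟩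

lemma IsAffineNear.potentialField_eventuallyEq {d : ℕ} (ξ b₀ b₁ : EuclideanSpace ℝ (Fin d))
    {h : Plane → ℝ} {x : Plane} {p q : ℝ} (hx : IsAffineNear h x p q) :
    ∀ᶠ y in 𝓝 x, potentialField ξ b₀ b₁ h y = ξ + p • b₀ + q • b₁ := by
  filter_upwards [hx.eventually] with y hy
  rw [potentialField, hy.partialDeriv_eq.1, hy.partialDeriv_eq.2]

lemma potentialField_eq_of_notMem_tsupport {d : ℕ} (ξ b₀ b₁ : EuclideanSpace ℝ (Fin d))
    {h : Plane → ℝ} {x : Plane} (hx : x ∉ tsupport h) : potentialField ξ b₀ b₁ h x = ξ := by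
  have : IsAffineNear h x 0 0 := ⟨0, by
    filter_upwards [notMem_tsupport_iff_eventuallyEq.1 hx] with y hy
    simp [hy]⟩
  simpa using (this.potentialField_eventuallyEq ξ b₀ b₁).self_of_nhds

lemma abs_partialDeriv_le {h : Plane → ℝ} {L : NNReal} (hL : LipschitzWith L h) (i : Fin 2)
    (x : Plane) : |partialDeriv i h x| ≤ L := by
  simpa [partialDeriv] using norm_lineDeriv_le_of_lipschitz ℝ (x₀ := x)
    (v := EuclideanSpace.single i (1 : ℝ)) hL

lemma measurable_partialDeriv {h : Plane → ℝ} (hc : Continuous h) (i : Fin 2) :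
    Measurable (partialDeriv i h) := measurable_lineDeriv hc

lemma integrable_partialDeriv_mul {h k : Plane → ℝ} {L : NNReal} (hL : LipschitzWith L h)
    (i : Fin 2) (hk : Integrable k) : Integrable fun x => partialDeriv i h x * k x :=
  hk.bdd_mul (measurable_partialDeriv hL.continuous i).aestronglyMeasurable
    (Eventually.of_forall fun x => abs_partialDeriv_le hL i x)

lemma norm_potentialField_le {d : ℕ} (ξ b₀ b₁ : EuclideanSpace ℝ (Fin d))
    {h : Plane → ℝ} {L : NNReal} (hL : LipschitzWith L h) (x : Plane) :
    ‖potentialField ξ b₀ b₁ h x‖ ≤ ‖ξ‖ + L * ‖b₀‖ + L * ‖b₁‖ := by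
  refine (norm_add₃_le).trans ?_
  rw [norm_smul, norm_smul, Real.norm_eq_abs, Real.norm_eq_abs]
  gcongr <;> exact abs_partialDeriv_le hL _ x

/-- A bounded function that is locally constant almost everywhere, with finitely many values, is
piecewise constant: the pieces are the interiors of its level sets. -/
lemma isBoundedPiecewiseConst_of_ae_eventuallyEq {N d : ℕ}
    {u : EuclideanSpace ℝ (Fin N) → EuclideanSpace ℝ (Fin d)} {M : ℝ} (hM : ∀ x, ‖u x‖ ≤ M)
    (S : Finset (EuclideanSpace ℝ (Fin d)))
    (hS : ∀ᵐ x, ∃ c ∈ S, ∀ᶠ y in 𝓝 x, u y = c) : IsBoundedPiecewiseConst u := by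
  refine ⟨⟨M, hM⟩, S.card,
    fun i => interior (u ⁻¹' {(S.equivFin.symm i : EuclideanSpace ℝ (Fin d))}),
    fun i => S.equivFin.symm i, fun i => isOpen_interior, ?_, ?_, ?_⟩
  · intro i j hij
    refine Set.disjoint_left.2 fun x hx hx' => hij ?_
    have h1 : x ∈ u ⁻¹' {↑(S.equivFin.symm i)} := interior_subset hx
    have h2 : x ∈ u ⁻¹' {↑(S.equivFin.symm j)} := interior_subset hx'
    exact S.equivFin.symm.injective (Subtype.ext ((show u x = _ from h1).symm.trans h2))
  · rw [← compl_mem_ae_iff, compl_compl]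
    filter_upwards [hS] with x hx
    obtain ⟨c, hc, hx⟩ := hx
    refine Set.mem_iUnion.2 ⟨S.equivFin ⟨c, hc⟩, mem_interior_iff_mem_nhds.2 ?_⟩
    filter_upwards [hx] with y hy
    simpa using hy
  · intro i x hx
    have h1 : x ∈ u ⁻¹' {↑(S.equivFin.symm i)} := interior_subset hx
    exact h1

/-! ### Distributional equation -/

lemma contDiff_fderiv_apply {E G : Type*} [NormedAddCommGroup E] [NormedSpace ℝ E]
    [NormedAddCommGroup G] [NormedSpace ℝ G] {φ : E → G} (hφ : ContDiff ℝ ∞ φ) (v : E) :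
    ContDiff ℝ ∞ fun x => fderiv ℝ φ x v :=
  (hφ.fderiv_right (m := ∞) (by simp)).clm_apply contDiff_const

/-- Integration by parts of a Lipschitz function against a test function. -/
lemma integral_partialDeriv_mul {h g : Plane → ℝ} {L : NNReal} (hL : LipschitzWith L h)
    (hg : ContDiff ℝ ∞ g) (hgc : HasCompactSupport g) (i : Fin 2) :
    ∫ x, partialDeriv i h x * g x = -∫ x, fderiv ℝ g x (EuclideanSpace.single i 1) * h x := by
  obtain ⟨D, hD⟩ := hg.lipschitzWith_of_hasCompactSupport hgc (by simp)
  rw [← integral_neg]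
  refine (hL.integral_lineDeriv_mul_eq hD hgc _).trans (integral_congr_ae (Eventually.of_forall ?_))
  intro x
  simp only
  rw [((hg.differentiable (by simp)) x).lineDeriv_eq_fderiv, map_neg, neg_mul]

/-- The rotated gradient `(-∂₁h, ∂₀h)` is divergence free. -/
lemma integral_partialDeriv_comm {h ψ : Plane → ℝ} {L : NNReal} (hL : LipschitzWith L h)
    (hψ : ContDiff ℝ ∞ ψ) (hψc : HasCompactSupport ψ) :
    ∫ x, partialDeriv 0 h x * fderiv ℝ ψ x (EuclideanSpace.single 1 1) =
      ∫ x, partialDeriv 1 h x * fderiv ℝ ψ x (EuclideanSpace.single 0 1) := by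
  rw [integral_partialDeriv_mul hL (contDiff_fderiv_apply hψ _) (hψc.fderiv_apply ℝ _),
    integral_partialDeriv_mul hL (contDiff_fderiv_apply hψ _) (hψc.fderiv_apply ℝ _)]
  congr 2
  ext x
  have hd : DifferentiableAt ℝ (fderiv ℝ ψ) x :=
    (hψ.fderiv_right (m := ∞) (by simp)).differentiable (by simp) x
  have hsymm : IsSymmSndFDerivAt ℝ ψ x :=
    (contDiff_infty.1 hψ 2).contDiffAt.isSymmSndFDerivAt (by simp)
  have e : ∀ v w : Plane, fderiv ℝ (fun y => fderiv ℝ ψ y v) x w = fderiv ℝ (fderiv ℝ ψ) x w v := by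
    intro v w
    rw [fderiv_clm_apply hd (differentiableAt_const v)]
    simp
  rw [e, e, hsymm.eq]

lemma integral_fderiv_apply_eq_zero {ψ : Plane → ℝ} (hψ : ContDiff ℝ ∞ ψ)
    (hψc : HasCompactSupport ψ) (i : Fin 2) :
    ∫ x, fderiv ℝ ψ x (EuclideanSpace.single i 1) = 0 := by
  have := integral_partialDeriv_mul (LipschitzWith.const (1 : ℝ)) hψ hψc i
  have h0 : ∀ x : Plane, partialDeriv i (fun _ => (1 : ℝ)) x = 0 := fun x => by
    simp [partialDeriv, lineDeriv]
  simpa [h0] using this.symm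

lemma integrable_fderiv_apply {ψ : Plane → ℝ} (hψ : ContDiff ℝ ∞ ψ)
    (hψc : HasCompactSupport ψ) (v : Plane) : Integrable fun x => fderiv ℝ ψ x v :=
  (contDiff_fderiv_apply hψ v).continuous.integrable_of_hasCompactSupport (hψc.fderiv_apply ℝ v)

/-- The hypotheses on `b₀`, `b₁` reduce `𝒜 u` to the commutator `∂₁∂₀h - ∂₀∂₁h` times
`A 1 b₀`. -/
theorem isDistribFree_potentialField {m d : ℕ} (A : Fin 2 → Matrix (Fin m) (Fin d) ℝ)
    {b₀ b₁ : EuclideanSpace ℝ (Fin d)} (h0 : Matrix.toEuclideanLin (A 0) b₀ = 0)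
    (h1 : Matrix.toEuclideanLin (A 1) b₁ = 0)
    (h01 : Matrix.toEuclideanLin (A 0) b₁ + Matrix.toEuclideanLin (A 1) b₀ = 0)
    (ξ : EuclideanSpace ℝ (Fin d)) {h : Plane → ℝ} {L : NNReal} (hL : LipschitzWith L h) :
    IsDistribFree A (potentialField ξ b₀ b₁ h) := by
  intro φ hφ hφc
  have hin : ∀ c : EuclideanSpace ℝ (Fin m), ContDiff ℝ ∞ (fun x => inner ℝ c (φ x)) ∧
      HasCompactSupport (fun x => inner ℝ c (φ x)) ∧
      ∀ x v, inner ℝ c (fderiv ℝ φ x v) = fderiv ℝ (fun y => inner ℝ c (φ y)) x v := by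
    intro c
    refine ⟨contDiff_const.inner ℝ hφ, hφc.comp_left (g := fun z => inner ℝ c z) (by simp), ?_⟩
    intro x v
    rw [fderiv_inner_apply ℝ (differentiableAt_const c) (hφ.differentiable (by simp) x)]
    simp
  have e : Matrix.toEuclideanLin (A 0) b₁ = -Matrix.toEuclideanLin (A 1) b₀ :=
    eq_neg_of_add_eq_zero_left h01
  set c := Matrix.toEuclideanLin (A 1) b₀ with hc
  set ψ : EuclideanSpace ℝ (Fin m) → Plane → ℝ := fun c x => inner ℝ c (φ x) with hψ
  have hexp : ∀ x, ∑ i, inner ℝ (Matrix.toEuclideanLin (A i) (potentialField ξ b₀ b₁ h x))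
        (fderiv ℝ φ x (EuclideanSpace.single i (1 : ℝ))) =
      (fderiv ℝ (ψ (Matrix.toEuclideanLin (A 0) ξ)) x (EuclideanSpace.single 0 1) +
      fderiv ℝ (ψ (Matrix.toEuclideanLin (A 1) ξ)) x (EuclideanSpace.single 1 1)) +
      (partialDeriv 0 h x * fderiv ℝ (ψ c) x (EuclideanSpace.single 1 1) -
        partialDeriv 1 h x * fderiv ℝ (ψ c) x (EuclideanSpace.single 0 1)) := by
    intro x
    rw [Fin.sum_univ_two]
    simp only [hψ, ← (hin _).2.2, potentialField, map_add, map_smul, h0, h1, e, ← hc,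
      inner_add_left, inner_smul_left, inner_neg_left, smul_zero, inner_zero_left]
    simp
    ring
  have i0 : ∀ c v, Integrable fun x => fderiv ℝ (ψ c) x v := fun c v =>
    integrable_fderiv_apply (hin c).1 (hin c).2.1 v
  have i1 := fun i j => integrable_partialDeriv_mul hL i (i0 c (EuclideanSpace.single j 1))
  have z : ∀ c i, ∫ x, fderiv ℝ (ψ c) x (EuclideanSpace.single i 1) = 0 := fun c i =>
    integral_fderiv_apply_eq_zero (hin c).1 (hin c).2.1 i
  have z1 := integral_partialDeriv_comm hL (hin c).1 (hin c).2.1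
  simp_rw [hexp]
  refine (integral_add ((i0 _ _).add (i0 _ _)) ((i1 _ _).sub (i1 _ _))).trans ?_
  have z2 := (integral_add (i0 (Matrix.toEuclideanLin (A 0) ξ) (EuclideanSpace.single 0 1))
    (i0 (Matrix.toEuclideanLin (A 1) ξ) (EuclideanSpace.single 1 1)))
  have z3 := integral_sub (i1 0 1) (i1 1 0)
  rw [z, z, add_zero] at z2
  rw [z1, sub_self] at z3
  exact (congrArg₂ (· + ·) z2 z3).trans (add_zero 0)

/-! ### Weak-* convergence -/

/-- If potentials tend to `0` uniformly while their gradients stay bounded, the gradients tend to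
`0` weakly-*. -/
theorem tendsto_integral_partialDeriv_mul {h : ℕ → Plane → ℝ}
    (hL : ∀ n, ∃ L, LipschitzWith L (h n)) {ρ : ℕ → ℝ} (hρ : Tendsto ρ atTop (𝓝 0))
    (hhρ : ∀ n x, |h n x| ≤ ρ n) (i : Fin 2) {M : ℝ}
    (hM : ∀ n, ∀ᵐ x, |partialDeriv i (h n) x| ≤ M) {k : Plane → ℝ} (hk : Integrable k) :
    Tendsto (fun n => ∫ x, partialDeriv i (h n) x * k x) atTop (𝓝 0) := by
  rw [Metric.tendsto_nhds]
  intro ε hε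
  have hM0 : 0 ≤ M := by
    obtain ⟨x, hx⟩ := (hM 0).exists
    exact (abs_nonneg _).trans hx
  have hε' : 0 < ε / (2 * (M + 1)) := by positivity
  obtain ⟨g, hgc, hg, hkg⟩ := (memLp_one_iff_integrable.2 hk).exist_eLpNorm_sub_le
    ENNReal.one_ne_top le_rfl hε'
  have hgi : Integrable g := hg.continuous.integrable_of_hasCompactSupport hgc
  have hki : Integrable fun x => k x - g x := hk.sub hgi
  have hkg' : ∫ x, ‖k x - g x‖ ≤ ε / (2 * (M + 1)) := by
    rw [integral_norm_eq_lintegral_enorm hki.aestronglyMeasurable]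
    rw [eLpNorm_one_eq_lintegral_enorm] at hkg
    exact ENNReal.toReal_le_of_le_ofReal hε'.le hkg
  have hdi := integrable_fderiv_apply hg hgc (EuclideanSpace.single i 1)
  set I := ∫ x, ‖fderiv ℝ g x (EuclideanSpace.single i 1)‖ with hI
  have hlim : Tendsto (fun n => ρ n * I) atTop (𝓝 0) := by simpa using hρ.mul_const I
  filter_upwards [hlim.eventually (gt_mem_nhds (half_pos hε))] with n hn
  obtain ⟨L, hLn⟩ := hL n
  rw [dist_zero_right]
  have hsplit : ∫ x, partialDeriv i (h n) x * k x = (∫ x, partialDeriv i (h n) x * (k x - g x)) -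
      ∫ x, fderiv ℝ g x (EuclideanSpace.single i 1) * h n x := by
    rw [sub_eq_add_neg, ← integral_partialDeriv_mul hLn hg hgc,
      ← integral_add (integrable_partialDeriv_mul hLn i hki)
        (integrable_partialDeriv_mul hLn i hgi)]
    exact integral_congr_ae (Eventually.of_forall fun x => by ring)
  have h1 : ‖∫ x, partialDeriv i (h n) x * (k x - g x)‖ ≤ M * ∫ x, ‖k x - g x‖ := by
    rw [← integral_const_mul]
    refine norm_integral_le_of_norm_le (hki.norm.const_mul M) ?_
    filter_upwards [hM n] with x hx
    rw [norm_mul]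
    exact mul_le_mul_of_nonneg_right hx (norm_nonneg _)
  have h2 : ‖∫ x, fderiv ℝ g x (EuclideanSpace.single i 1) * h n x‖ ≤ ρ n * I := by
    rw [hI, ← integral_const_mul]
    refine norm_integral_le_of_norm_le (hdi.norm.const_mul _) (Eventually.of_forall fun x => ?_)
    rw [norm_mul, mul_comm]
    exact mul_le_mul_of_nonneg_right (hhρ n x) (norm_nonneg _)
  have h3 : M * ∫ x, ‖k x - g x‖ ≤ ε / 2 := by
    calc _ ≤ (M + 1) * (ε / (2 * (M + 1))) := by
          gcongr
          linarith
      _ = ε / 2 := by field_simp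
  rw [hsplit]
  calc _ ≤ _ := norm_sub_le _ _
    _ < ε := by linarith

theorem weakStarTendsto_potentialField {d : ℕ} (ξ b₀ b₁ : EuclideanSpace ℝ (Fin d))
    {h : ℕ → Plane → ℝ} (hL : ∀ n, ∃ L, LipschitzWith L (h n)) {ρ : ℕ → ℝ}
    (hρ : Tendsto ρ atTop (𝓝 0)) (hhρ : ∀ n x, |h n x| ≤ ρ n) {M : ℝ}
    (hM : ∀ n i, ∀ᵐ x, |partialDeriv i (h n) x| ≤ M) :
    WeakStarTendsto (fun n => potentialField ξ b₀ b₁ (h n)) fun _ => ξ := by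
  intro g hg
  have hi : ∀ b : EuclideanSpace ℝ (Fin d), Integrable fun x => inner ℝ b (g x) :=
    fun b => hg.const_inner b
  have hlim := ((tendsto_integral_partialDeriv_mul hL hρ hhρ 0 (fun n => hM n 0) (hi b₀)).const_add
    (∫ x, inner ℝ ξ (g x))).add
    (tendsto_integral_partialDeriv_mul hL hρ hhρ 1 (fun n => hM n 1) (hi b₁))
  simp only [add_zero] at hlim
  refine hlim.congr fun n => ?_
  obtain ⟨L, hLn⟩ := hL n
  have j0 := integrable_partialDeriv_mul hLn 0 (hi b₀)
  have j1 := integrable_partialDeriv_mul hLn 1 (hi b₁)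
  rw [← integral_add (hi ξ) j0]
  refine (integral_add ((hi ξ).add j0) j1).symm.trans (integral_congr_ae
    (Eventually.of_forall fun x => ?_))
  simp [potentialField, inner_add_left, inner_smul_left]

/-! ### Algebra of the operator -/

/-- Potentials for the operator `f ∂₀ + g ∂₁`: the three equations say that `∂₀h • b₀ + ∂₁h • b₁`
solves it for every scalar `h`. They can be met because `dim V = 2 dim W` and `ker f ∩ ker g = 0`
force `f` to map `ker g` isomorphically onto `W`, and `b₁` is then the preimage of `-g b₀`. -/
lemma exists_mem_ker_map_add_eq_zero {V W : Type*} [AddCommGroup V] [Module ℝ V] [AddCommGroup W]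
    [Module ℝ W] [FiniteDimensional ℝ V] [FiniteDimensional ℝ W]
    (hVW : Module.finrank ℝ V = 2 * Module.finrank ℝ W) (hW : 0 < Module.finrank ℝ W)
    (f g : V →ₗ[ℝ] W) (hfg : LinearMap.ker f ⊓ LinearMap.ker g = ⊥) :
    ∃ b₀ b₁ : V, b₀ ≠ 0 ∧ f b₀ = 0 ∧ g b₁ = 0 ∧ f b₁ + g b₀ = 0 := by
  have hker : ∀ k : V →ₗ[ℝ] W, Module.finrank ℝ W ≤ Module.finrank ℝ (LinearMap.ker k) := by
    intro k
    have h1 := LinearMap.finrank_range_add_finrank_ker k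
    have h2 := Submodule.finrank_le (LinearMap.range k)
    omega
  obtain ⟨b₀, hb₀⟩ := Module.finrank_pos_iff_exists_ne_zero.1 (hW.trans_le (hker f))
  have hinj : Function.Injective (f.domRestrict (LinearMap.ker g)) := by
    rw [← LinearMap.ker_eq_bot, LinearMap.ker_eq_bot']
    intro x hx
    have : (x : V) ∈ LinearMap.ker f ⊓ LinearMap.ker g := ⟨hx, x.2⟩
    rw [hfg] at this
    exact Subtype.ext this
  have hsurj : Function.Surjective (f.domRestrict (LinearMap.ker g)) := by
    rw [← LinearMap.range_eq_top]
    refine Submodule.eq_top_of_finrank_eq (le_antisymm (Submodule.finrank_le _) ?_)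
    rw [LinearMap.finrank_range_of_inj hinj]
    exact hker g
  obtain ⟨b₁, hb₁⟩ := hsurj (-g b₀)
  refine ⟨b₀, b₁, by simpa using hb₀, b₀.2, b₁.2, ?_⟩
  have : f b₁ = -g b₀ := hb₁
  rw [this, neg_add_cancel]

lemma mem_charCone_of_apply_eq_zero {m d : ℕ} (A : Fin 2 → Matrix (Fin m) (Fin d) ℝ)
    {v : EuclideanSpace ℝ (Fin d)} (hv : Matrix.toEuclideanLin (A 0) v = 0) : v ∈ charCone A := by
  refine ⟨EuclideanSpace.single 0 1, by simp, ?_⟩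
  simpa [symbol] using hv

lemma IsConvexAlong.le_of_real {d : ℕ} {L : Set (EuclideanSpace ℝ (Fin d))}
    {F : EuclideanSpace ℝ (Fin d) → ℝ} (hF : IsConvexAlong L fun ξ => (F ξ : EReal))
    {a b : EuclideanSpace ℝ (Fin d)} (hab : b - a ∈ L) {t : ℝ} (h0 : 0 < t) (h1 : t < 1) :
    F (t • a + (1 - t) • b) ≤ t * F a + (1 - t) * F b := by
  have h : (F (t • a + (1 - t) • b) : EReal) ≤ (t : EReal) * F a + ((1 - t : ℝ) : EReal) * F b :=
    hF.2 a b hab t h0 h1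
  exact_mod_cast h

/-! ### Laminate hull and relaxation -/

/-- A coercive function that is negative at `ξ` vanishes somewhere on every ray from `ξ`. -/
lemma exists_pos_apply_add_smul_eq_zero {V : Type*} [NormedAddCommGroup V] [NormedSpace ℝ V]
    {F : V → ℝ} (hc : Continuous F) (hco : Tendsto F (Bornology.cobounded V) atTop) {ξ v : V}
    (hξ : F ξ < 0) (hv : v ≠ 0) : ∃ τ : ℝ, 0 < τ ∧ F (ξ + τ • v) = 0 := by
  have hcob : Tendsto (fun τ : ℝ => ξ + τ • v) atTop (Bornology.cobounded V) := by
    rw [← tendsto_norm_atTop_iff_cobounded]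
    have h1 : Tendsto (fun τ : ℝ => τ * ‖v‖ - ‖ξ‖) atTop atTop :=
      tendsto_atTop_add_const_right _ _ (tendsto_id.atTop_mul_const (norm_pos_iff.2 hv))
    refine tendsto_atTop_mono (fun τ => ?_) h1
    have h2 : ‖τ • v‖ ≤ ‖ξ + τ • v‖ + ‖ξ‖ := by
      simpa using norm_sub_le (ξ + τ • v) ξ
    rw [norm_smul, Real.norm_eq_abs] at h2
    have h3 : τ * ‖v‖ ≤ |τ| * ‖v‖ := by gcongr; exact le_abs_self τ
    linarith
  obtain ⟨T, hT0, hT⟩ := ((eventually_gt_atTop 0).and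
    ((hco.comp hcob).eventually (eventually_ge_atTop 0))).exists
  have hcont : ContinuousOn (fun τ : ℝ => F (ξ + τ • v)) (Set.Icc 0 T) := by fun_prop
  obtain ⟨τ, hτ, hτ0⟩ := intermediate_value_Icc hT0.le hcont
    (show (0 : ℝ) ∈ Set.Icc (F (ξ + (0 : ℝ) • v)) (F (ξ + T • v)) from ⟨by simpa using hξ.le, hT⟩)
  refine ⟨τ, lt_of_le_of_ne hτ.1 ?_, hτ0⟩
  rintro rfl
  simp only [zero_smul, add_zero] at hτ0
  linarith

lemma setOf_lt_zero_subset_interior {V : Type*} [TopologicalSpace V] {F : V → ℝ}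
    (hc : Continuous F) : {ξ | F ξ < 0} ⊆ interior {ξ | F ξ ≤ 0} :=
  interior_maximal (fun ξ (h : F ξ < 0) => h.le) (isOpen_lt hc continuous_const)

section Coercive

variable {d : ℕ} {L : Set (EuclideanSpace ℝ (Fin d))} {F : EuclideanSpace ℝ (Fin d) → ℝ}

/-- Every point of `{F < 0}` lies on a segment in a `Λ`-direction with both ends in `{F = 0}`. -/
theorem laminateHull_zero_set (hc : Continuous F)
    (hF : IsConvexAlong L fun ξ => (F ξ : EReal))
    (hco : Tendsto F (Bornology.cobounded (EuclideanSpace ℝ (Fin d))) atTop)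
    {v : EuclideanSpace ℝ (Fin d)} (hv : v ≠ 0) (hvL : ∀ τ : ℝ, τ • v ∈ L) :
    laminateHull L {ξ | F ξ = 0} = {ξ | F ξ ≤ 0} := by
  ext ξ
  constructor
  · intro h
    have := h (fun ξ => (F ξ : EReal)) hF (fun η (hη : F η = 0) => by simp [hη])
    exact_mod_cast this
  · intro h G hG hG0
    rcases (show F ξ ≤ 0 from h).lt_or_eq with h | h
    · obtain ⟨a, ha, ha0⟩ := exists_pos_apply_add_smul_eq_zero hc hco h hv
      obtain ⟨b, hb, hb0⟩ := exists_pos_apply_add_smul_eq_zero hc hco h (neg_ne_zero.2 hv)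
      have hab : 0 < a + b := by positivity
      have := hG.2 (ξ + a • v) (ξ + b • -v) (by
        have e : (ξ + b • -v) - (ξ + a • v) = (-(a + b)) • v := by module
        rw [e]; exact hvL _) (b / (a + b)) (by positivity) (by rw [div_lt_one hab]; linarith)
      rw [hG0 _ ha0, hG0 _ hb0, mul_zero, mul_zero, add_zero] at this
      have e : (b / (a + b)) • (ξ + a • v) + (1 - b / (a + b)) • (ξ + b • -v) = ξ := by
        match_scalars <;> field_simp <;> ring
      rwa [e] at this
    · exact (hG0 ξ h).le

/-- Convexity along `v` keeps `F` negative on the open segment from `ξ` to the zero `ξ + τ • v`, so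
points of `{F < 0}` on it come arbitrarily close to `{F = 0}`. -/
lemma exists_smul_lt_zero_infEDist_lt
    (hF : IsConvexAlong L fun ξ => (F ξ : EReal)) {v ξ : EuclideanSpace ℝ (Fin d)}
    (hvL : ∀ τ : ℝ, τ • v ∈ L) (hξ : F ξ < 0) {τ : ℝ} (hτ : 0 < τ) (hτ0 : F (ξ + τ • v) = 0)
    {ε : ENNReal} (hε : 0 < ε) :
    ∃ t, 0 < t ∧ t ≤ τ ∧ F (ξ + t • v) < 0 ∧ Metric.infEDist (ξ + t • v) {η | F η = 0} < ε := by
  have hcont : Continuous fun t : ℝ => Metric.infEDist (ξ + t • v) {η | F η = 0} :=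
    Metric.continuous_infEDist.comp (by fun_prop)
  have h0 : Metric.infEDist (ξ + τ • v) {η | F η = 0} < ε := by
    rwa [Metric.infEDist_zero_of_mem (show ξ + τ • v ∈ {η | F η = 0} from hτ0)]
  obtain ⟨t, ht, ht'⟩ := (((hcont.tendsto τ).eventually (gt_mem_nhds h0)).filter_mono
    nhdsWithin_le_nhds |>.and (Ioo_mem_nhdsLT hτ)).exists
  refine ⟨t, ht'.1, ht'.2.le, ?_, ht⟩
  have hr : t / τ < 1 := (div_lt_one hτ).2 ht'.2
  have := hF.le_of_real (a := ξ + τ • v) (b := ξ) (t := t / τ) (by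
    have e : ξ - (ξ + τ • v) = (-τ) • v := by module
    rw [e]; exact hvL _) (div_pos ht'.1 hτ) hr
  have e : (t / τ) • (ξ + τ • v) + (1 - t / τ) • ξ = ξ + t • v := by
    match_scalars <;> field_simp
    ring
  rw [e, hτ0, mul_zero, zero_add] at this
  exact this.trans_lt (mul_neg_of_pos_of_neg (by linarith) hξ)

/-- The four values `ξ + p • b₀ + q • b₁` taken by the field of a tent can be placed in `{F < 0}`
and arbitrarily close to `{F = 0}`, with slopes bounded independently of `ε`. -/
lemma exists_tent_slopes (hc : Continuous F)
    (hF : IsConvexAlong L fun ξ => (F ξ : EReal)) {b₀ ξ : EuclideanSpace ℝ (Fin d)}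
    (b₁ : EuclideanSpace ℝ (Fin d)) (hL : ∀ τ : ℝ, τ • b₀ ∈ L) (hξ : F ξ < 0) {σ τ : ℝ}
    (hσ : 0 < σ) (hσ0 : F (ξ + σ • -b₀) = 0) (hτ : 0 < τ) (hτ0 : F (ξ + τ • b₀) = 0)
    {ε : ENNReal} (hε : 0 < ε) :
    ∃ s t δ : ℝ, 0 < s ∧ 0 < t ∧ 0 < δ ∧ s ≤ σ ∧ t ≤ τ ∧ δ ≤ 1 ∧
      ∀ p q : ℝ, (p = -s ∨ p = t) → (q = δ ∨ q = -δ) → F (ξ + p • b₀ + q • b₁) < 0 ∧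
        Metric.infEDist (ξ + p • b₀ + q • b₁) {η | F η = 0} < ε := by
  obtain ⟨t, ht, htτ, ht0, htε⟩ := exists_smul_lt_zero_infEDist_lt hF hL hξ hτ hτ0 hε
  obtain ⟨s, hs, hsσ, hs0, hsε⟩ := exists_smul_lt_zero_infEDist_lt hF (v := -b₀)
    (fun r => by simpa using hL (-r)) hξ hσ hσ0 hε
  have key : ∀ p : ℝ, F (ξ + p • b₀) < 0 → Metric.infEDist (ξ + p • b₀) {η | F η = 0} < ε →
      ∀ᶠ q in 𝓝 (0 : ℝ), F (ξ + p • b₀ + q • b₁) < 0 ∧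
        Metric.infEDist (ξ + p • b₀ + q • b₁) {η | F η = 0} < ε := by
    intro p hp hpε
    have hl : Tendsto (fun q : ℝ => ξ + p • b₀ + q • b₁) (𝓝 0) (𝓝 (ξ + p • b₀)) := by
      have : Continuous fun q : ℝ => ξ + p • b₀ + q • b₁ := by fun_prop
      simpa using this.tendsto 0
    exact (((hc.tendsto _).comp hl).eventually (gt_mem_nhds hp)).and
      (((Metric.continuous_infEDist.tendsto _).comp hl).eventually (gt_mem_nhds hpε))
  have e : ξ + s • -b₀ = ξ + (-s) • b₀ := by module
  rw [e] at hs0 hsε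
  obtain ⟨η, hη, hball⟩ := Metric.eventually_nhds_iff.1 ((key t ht0 htε).and (key (-s) hs0 hsε))
  have hδ : 0 < min (η / 2) 1 := by positivity
  have hlt : min (η / 2) 1 < η := (min_le_left _ _).trans_lt (by linarith)
  refine ⟨s, t, min (η / 2) 1, hs, ht, hδ, hsσ, htτ, min_le_right _ _, ?_⟩
  intro p q hp hq
  have hq' : dist q 0 < η := by
    rcases hq with rfl | rfl <;> simpa [abs_of_pos hδ] using hlt
  rcases hp with rfl | rfl
  · exact (hball hq').2
  · exact (hball hq').1

/-- One term of the relaxing sequence: a small potential whose field takes finitely many values, all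
in `{F < 0}` and mostly close to `{F = 0}`. The gradient bound does not depend on `ρ`, as the weak-*
limit requires. -/
lemma exists_potential (hc : Continuous F)
    (hF : IsConvexAlong L fun ξ => (F ξ : EReal)) {b₀ ξ : EuclideanSpace ℝ (Fin d)}
    (b₁ : EuclideanSpace ℝ (Fin d)) (hL : ∀ τ : ℝ, τ • b₀ ∈ L) (hξ : F ξ < 0) {σ τ : ℝ}
    (hσ : 0 < σ) (hσ0 : F (ξ + σ • -b₀) = 0) (hτ : 0 < τ) (hτ0 : F (ξ + τ • b₀) = 0)
    {Ω : Set Plane} (hΩ : IsOpen Ω) (hb : Bornology.IsBounded Ω) {ρ : ℝ} (hρ : 0 < ρ) :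
    ∃ h : Plane → ℝ, (∃ K, LipschitzWith K h) ∧ tsupport h ⊆ Ω ∧ (∀ x, |h x| ≤ ρ) ∧
      (∀ i, ∀ᵐ x, |partialDeriv i h x| ≤ σ + τ + 1) ∧
      IsBoundedPiecewiseConst (potentialField ξ b₀ b₁ h) ∧
      (∀ᵐ x, F (potentialField ξ b₀ b₁ h x) < 0) ∧
      ∫⁻ x in Ω, Metric.infEDist (potentialField ξ b₀ b₁ h x) {η | F η = 0} ≤
        ENNReal.ofReal ρ * volume Ω + Metric.infEDist ξ {η | F η = 0} * ENNReal.ofReal ρ := by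
  classical
  obtain ⟨s, t, δ, hs, ht, hδ, hsσ, htτ, hδ1, hval⟩ := exists_tent_slopes hc hF b₁ hL hξ hσ hσ0
    hτ hτ0 (ENNReal.ofReal_pos.2 hρ)
  obtain ⟨h, C, ⟨K, hK⟩, hsupp, hhρ, hCc, hvol, hae⟩ :=
    exists_tent_filling hs ht hδ hΩ hb hρ
  refine ⟨h, ⟨K, hK⟩, hsupp, hhρ, ?_, ?_, ?_, ?_⟩
  · intro i
    filter_upwards [hae] with x hx
    rcases hx with ⟨-, hx⟩ | ⟨-, p, q, hp, hq, hx⟩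
    · fin_cases i
      · simp only [Fin.zero_eta, hx.partialDeriv_eq.1, abs_zero]; positivity
      · simp only [Fin.mk_one, hx.partialDeriv_eq.2, abs_zero]; positivity
    · fin_cases i
      · simp only [Fin.zero_eta, hx.partialDeriv_eq.1, abs_le]
        rcases hp with rfl | rfl <;> constructor <;> linarith
      · simp only [Fin.mk_one, hx.partialDeriv_eq.2, abs_le]
        rcases hq with rfl | rfl <;> constructor <;> linarith
  · refine isBoundedPiecewiseConst_of_ae_eventuallyEq (norm_potentialField_le ξ b₀ b₁ hK)
      ((({0, -s, t} : Finset ℝ) ×ˢ ({0, δ, -δ} : Finset ℝ)).image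
        fun z => ξ + z.1 • b₀ + z.2 • b₁) ?_
    filter_upwards [hae] with x hx
    rcases hx with ⟨-, hx⟩ | ⟨-, p, q, hp, hq, hx⟩
    · exact ⟨_, Finset.mem_image.2 ⟨(0, 0), by simp, rfl⟩, hx.potentialField_eventuallyEq _ _ _⟩
    · refine ⟨_, Finset.mem_image.2 ⟨(p, q), ?_, rfl⟩, hx.potentialField_eventuallyEq _ _ _⟩
      simp only [Finset.mem_product, Finset.mem_insert, Finset.mem_singleton]
      exact ⟨Or.inr hp, Or.inr hq⟩
  · filter_upwards [hae] with x hx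
    rcases hx with ⟨-, hx⟩ | ⟨-, p, q, hp, hq, hx⟩
    · rw [(hx.potentialField_eventuallyEq ξ b₀ b₁).self_of_nhds]
      simpa using hξ
    · rw [(hx.potentialField_eventuallyEq ξ b₀ b₁).self_of_nhds]
      exact (hval p q hp hq).1
  · calc ∫⁻ x in Ω, Metric.infEDist (potentialField ξ b₀ b₁ h x) {η | F η = 0}
        ≤ ∫⁻ x in Ω, (ENNReal.ofReal ρ +
            Cᶜ.indicator (fun _ => Metric.infEDist ξ {η | F η = 0}) x) := by
          refine lintegral_mono_ae (ae_restrict_of_ae ?_)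
          filter_upwards [hae] with x hx
          rcases hx with ⟨hxC, hx⟩ | ⟨-, p, q, hp, hq, hx⟩
          · rw [(hx.potentialField_eventuallyEq ξ b₀ b₁).self_of_nhds,
              Set.indicator_of_mem (show x ∈ Cᶜ from hxC)]
            simp
          · rw [(hx.potentialField_eventuallyEq ξ b₀ b₁).self_of_nhds]
            exact (hval p q hp hq).2.le.trans le_self_add
      _ = ENNReal.ofReal ρ * volume Ω +
            Metric.infEDist ξ {η | F η = 0} * volume (Ω \ C) := by
          rw [lintegral_add_left measurable_const,
            lintegral_indicator_const hCc.measurableSet.compl,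
            Measure.restrict_apply hCc.measurableSet.compl, lintegral_const,
            Measure.restrict_apply_univ, Set.inter_comm, ← Set.sdiff_eq]
      _ ≤ _ := by gcongr

end Coercive

/-- If some `b₀ ≠ 0` is annihilated by `A 0` and has a companion `b₁` for which every field
`∂₀h • b₀ + ∂₁h • b₁` is `𝒜`-free, then one splitting along `b₀` already relaxes `{F ≤ 0}` to
`{F = 0}`. -/
theorem relaxationProperty_sublevel {m d : ℕ} (A : Fin 2 → Matrix (Fin m) (Fin d) ℝ)
    {b₀ b₁ : EuclideanSpace ℝ (Fin d)} (hb : b₀ ≠ 0) (h0 : Matrix.toEuclideanLin (A 0) b₀ = 0)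
    (h1 : Matrix.toEuclideanLin (A 1) b₁ = 0)
    (h01 : Matrix.toEuclideanLin (A 0) b₁ + Matrix.toEuclideanLin (A 1) b₀ = 0)
    {F : EuclideanSpace ℝ (Fin d) → ℝ} (hc : Continuous F)
    (hF : IsConvexAlong (charCone A) fun ξ => (F ξ : EReal))
    (hco : Tendsto F (Bornology.cobounded (EuclideanSpace ℝ (Fin d))) atTop) :
    RelaxationProperty A {ξ | F ξ ≤ 0} {ξ | F ξ = 0} := by
  intro Ω hΩ hbΩ ξ hξ
  have hL : ∀ τ : ℝ, τ • b₀ ∈ charCone A := fun τ =>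
    mem_charCone_of_apply_eq_zero A (by rw [map_smul, h0, smul_zero])
  have hξ0 : ξ ∈ {ξ | F ξ ≤ 0} := interior_subset hξ
  rcases (show F ξ ≤ 0 from hξ0).lt_or_eq with hlt | heq
  · obtain ⟨τ, hτ, hτ0⟩ := exists_pos_apply_add_smul_eq_zero hc hco hlt hb
    obtain ⟨σ, hσ, hσ0⟩ := exists_pos_apply_add_smul_eq_zero hc hco hlt (neg_ne_zero.2 hb)
    have hρ : ∀ n : ℕ, (0 : ℝ) < 1 / ((n : ℝ) + 1) := fun n => by positivity
    choose h hK hsupp hhρ hM hpc hneg hint using fun n : ℕ =>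
      exists_potential hc hF b₁ hL hlt hσ hσ0 hτ hτ0 hΩ hbΩ (hρ n)
    have hlim : Tendsto (fun n : ℕ => 1 / ((n : ℝ) + 1)) atTop (𝓝 0) :=
      tendsto_one_div_add_atTop_nhds_zero_nat
    refine ⟨fun n => potentialField ξ b₀ b₁ (h n), hpc,
      weakStarTendsto_potentialField ξ b₀ b₁ hK hlim hhρ hM,
      fun n x hx => potentialField_eq_of_notMem_tsupport ξ b₀ b₁ fun hx' => hx (hsupp n hx'),
      fun n => ?_, fun n => ?_, ?_⟩
    · obtain ⟨K, hK⟩ := hK n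
      exact isDistribFree_potentialField A h0 h1 h01 ξ hK
    · filter_upwards [ae_restrict_of_ae (hneg n)] with x hx
      exact Or.inr (setOf_lt_zero_subset_interior hc hx)
    · have hfin : Metric.infEDist ξ {η | F η = 0} ≠ ⊤ :=
        Metric.infEDist_ne_top ⟨ξ + τ • b₀, hτ0⟩
      have hvol : volume Ω ≠ ⊤ := hbΩ.measure_lt_top.ne
      have hl : Tendsto (fun n : ℕ => ENNReal.ofReal (1 / ((n : ℝ) + 1))) atTop (𝓝 0) := by
        simpa using ENNReal.tendsto_ofReal hlim
      have hl' := (ENNReal.Tendsto.mul_const hl (Or.inr hvol)).add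
        (ENNReal.Tendsto.const_mul hl (Or.inr hfin))
      rw [zero_mul, mul_zero, add_zero] at hl'
      exact tendsto_of_tendsto_of_tendsto_of_le_of_le tendsto_const_nhds hl'
        (fun _ => zero_le) hint
  · refine ⟨fun _ _ => ξ, fun n => isBoundedPiecewiseConst_of_ae_eventuallyEq (fun _ => le_rfl) {ξ}
      (by simp), fun g _ => tendsto_const_nhds, fun _ _ _ => rfl, fun n => ?_,
      fun n => Eventually.of_forall fun _ => Or.inl heq, ?_⟩
    · have := isDistribFree_potentialField A h0 h1 h01 ξ (LipschitzWith.const (0 : ℝ))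
      have e : potentialField ξ b₀ b₁ (fun _ => 0) = fun _ => ξ := by
        ext1 x
        exact potentialField_eq_of_notMem_tsupport ξ b₀ b₁ (by simp [tsupport])
      rwa [e] at this
    · simp [Metric.infEDist_zero_of_mem (show ξ ∈ {η | F η = 0} from heq)]

end AFree

theorem theorem3p4 (m : ℕ) (hm : 1 ≤ m) (A : Fin 2 → Matrix (Fin m) (Fin (2 * m)) ℝ)
    (hA : LinearMap.ker (Matrix.toEuclideanLin (A 0)) ⊓
      LinearMap.ker (Matrix.toEuclideanLin (A 1)) = ⊥)
    (F : EuclideanSpace ℝ (Fin (2 * m)) → ℝ)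
    (hFcont : Continuous F)
    (hFconv : AFree.IsConvexAlong (AFree.charCone A) (fun ξ => (F ξ : EReal)))
    (hFcoer : Tendsto F (Bornology.cobounded (EuclideanSpace ℝ (Fin (2 * m)))) atTop)
    (E : Set (EuclideanSpace ℝ (Fin (2 * m)))) (hE : E = {ξ | F ξ = 0}) :
    AFree.laminateHull (AFree.charCone A) E = {ξ | F ξ ≤ 0} ∧
      AFree.RelaxationProperty A (AFree.laminateHull (AFree.charCone A) E) E := by
  subst hE
  obtain ⟨b₀, b₁, hb, h0, h1, h01⟩ := AFree.exists_mem_ker_map_add_eq_zero (by simp)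
    (by simp; omega)
    _ _ hA
  have hhull := AFree.laminateHull_zero_set hFcont hFconv hFcoer hb fun τ =>
    AFree.mem_charCone_of_apply_eq_zero A (by rw [map_smul, h0, smul_zero])
  refine ⟨hhull, ?_⟩
  rw [hhull]
  exact AFree.relaxationProperty_sublevel A hb h0 h1 h01 hFcont hFconv hFcoer
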